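/- For each $n\ge 1$ let $T_n$ be an $n\times n$ transmittance matrix, i.e. a positive semidefinite complex matrix ($T_n=\tau_n^\dagger\tau_n$), with eigenvalues $0\le\lambda_1^{(n)}\le\dots\le\lambda_n^{(n)}$ (listed with multiplicity), and write $\bar\lambda^{(n)}=\frac1n\sum_{i=1}^n\lambda_i^{(n)}$. Let $p_n(t;T_n)$ be the transmissivity distribution, i.e. the law of $t=\mathbf a^\dagger T_n\mathbf a$ where $\mathbf a$ is uniformly distributed on the complex unit sphere $\mathcal S^{2n-1}=\{\mathbf z\in\mathbb C^n:|\mathbf z|=1\}$. **Central limit theorem.** Let $\mu,s\in\mathbb R$ and suppose that $$\lim_{n\to\infty}\frac{\log n}{\sqrt n}\,\lambda_n^{(n)}=0,\qquad \lim_{n\to\infty}\frac1n\sum_{i=1}^n\lambda_i^{(n)}=\mu,\qquad \lim_{n\to\infty}\frac1{n^2}\sum_{i>j}\bigl(\lambda_i^{(n)}-\lambda_j^{(n)}\bigr)^2=s^2 .$$ Then $p_n(t;T_n)$ is asymptotically the normal distribution with variance $s^2/(n+1)$ in the following sense (a normal distribution of variance $0$ being a Dirac mass): 1. if $t$ has distribution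 $p_n(t;T_n)$, then the law of $\sqrt{n+1}\,(t-\bar\lambda^{(n)})$ converges weakly to $\mathcal N(0,s^2)$ as $n\to\infty$; 2. if moreover $\sqrt n\,(\bar\lambda^{(n)}-\mu)\to0$, then the law of $\sqrt{n+1}\,(t-\mu)$ converges weakly to $\mathcal N(0,s^2)$ too; 3. without any normalization, $\int f\,\mathrm dp_n(\cdot\,;T_n)-\int f\,\mathrm d\mathcal N\bigl(\mu,\tfrac{s^2}{n+1}\bigr)\to0$ for every bounded continuous $f:\mathbb R\to\mathbb R$. **Passive systems.** If all eigenvalues of all $T_n$ lie in $[0,1]$, then the first of the three conditions holds automatically. If in addition the third condition holds, then $\frac{s^2}{n+1}\le\frac1{4(n+1)}$ for all $n$, with equality if, for infinitely many $n$, half of the eigenvalues of $T_n$ equal $0$ and half equal $1$. -/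

import Mathlib

open Filter Topology MeasureTheory ProbabilityTheory
open scoped ComplexOrder Matrix NNReal BoundedContinuousFunction

noncomputable section

namespace CoherentTransport

/-- The complex unit sphere `S^{2n-1} = {z ∈ ℂⁿ : |z| = 1}`. -/
abbrev ComplexSphere (n : ℕ) : Type :=
  Metric.sphere (0 : EuclideanSpace ℂ (Fin n)) 1

/-- The uniform probability distribution on `S^{2n-1}`: the surface measure induced by Lebesgue
measure on `ℂⁿ`, divided by its total mass. (For `n = 0` the sphere is empty and this is `0`.) -/
def uniformSphere (n : ℕ) : Measure (ComplexSphere n) :=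
  ((volume : Measure (EuclideanSpace ℂ (Fin n))).toSphere Set.univ)⁻¹ •
    (volume : Measure (EuclideanSpace ℂ (Fin n))).toSphere

/-- The transmissivity `t[a] = a† T a` of the normalized coherent input `a`; it is real for
Hermitian `T`. -/
def transmissivity {n : ℕ} (T : Matrix (Fin n) (Fin n) ℂ) (a : ComplexSphere n) : ℝ :=
  (star a.1.ofLp ⬝ᵥ (T *ᵥ a.1.ofLp)).re

/-- The transmissivity distribution `p_n(t; T)`, as a measure on the line: the law of `t[a]` for
`a` uniformly distributed on `S^{2n-1}`. -/
def transmissivityDistribution {n : ℕ} (T : Matrix (Fin n) (Fin n) ℂ) : Measure ℝ :=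
  (uniformSphere n).map (transmissivity T)

instance isProbabilityMeasure_uniformSphere (n : ℕ) [NeZero n] :
    IsProbabilityMeasure (uniformSphere n) := by
  constructor
  rw [uniformSphere, Measure.smul_apply, smul_eq_mul]
  exact ENNReal.inv_mul_cancel
    (by rw [Ne, Measure.measure_univ_eq_zero]; exact Measure.toSphere_ne_zero _)
    (measure_ne_top _ _)

theorem continuous_transmissivity {n : ℕ} (T : Matrix (Fin n) (Fin n) ℂ) :
    Continuous (transmissivity T) := by
  unfold transmissivity
  simp only [dotProduct, Matrix.mulVec]
  fun_prop

instance isProbabilityMeasure_transmissivityDistribution {n : ℕ} [NeZero n]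
    (T : Matrix (Fin n) (Fin n) ℂ) : IsProbabilityMeasure (transmissivityDistribution T) :=
  Measure.isProbabilityMeasure_map (continuous_transmissivity T).measurable.aemeasurable

instance isFiniteMeasure_transmissivityDistribution {n : ℕ} (T : Matrix (Fin n) (Fin n) ℂ) :
    IsFiniteMeasure (transmissivityDistribution T) := by
  rcases n with _ | n
  · have h : transmissivityDistribution T = 0 := by
      have : uniformSphere 0 = 0 := by
        apply Measure.eq_zero_of_isEmpty
      rw [transmissivityDistribution, this, Measure.map_zero]
    rw [h]
    infer_instance
  · infer_instance

/-- The law of `c (t - m)` for `t` distributed according to `p_n(t; T)`, as an element of the space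
of finite measures on the line, whose topology is that of weak convergence. -/
def normalizedDistribution {n : ℕ} (T : Matrix (Fin n) (Fin n) ℂ) (c m : ℝ) : FiniteMeasure ℝ :=
  ⟨(transmissivityDistribution T).map (fun t => c * (t - m)), inferInstance⟩

/-- The normal distribution with mean `m` and variance `v ≥ 0` (a Dirac mass if `v = 0`), as a
finite measure on the line. -/
def normalDistribution (m : ℝ) (v : ℝ≥0) : FiniteMeasure ℝ :=
  ⟨gaussianReal m v, inferInstance⟩

section Eigenvalues

variable {n : ℕ} {T : Matrix (Fin n) (Fin n) ℂ}

/-- The largest eigenvalue `λ_n` of a Hermitian matrix (for `n ≥ 1`). -/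
def maxEigenvalue (hT : T.IsHermitian) : ℝ := ⨆ i, hT.eigenvalues i

/-- The mean `(1/n) ∑ λ_i` of the eigenvalues. -/
def eigenvalueMean (hT : T.IsHermitian) : ℝ := (1 / (n : ℝ)) * ∑ i, hT.eigenvalues i

/-- The variance `(1/n²) ∑_{i>j} (λ_i - λ_j)²` of the eigenvalues. -/
def eigenvalueVariance (hT : T.IsHermitian) : ℝ :=
  (1 / (n : ℝ) ^ 2) * ∑ i, ∑ j ∈ Finset.Iio i, (hT.eigenvalues i - hT.eigenvalues j) ^ 2

end Eigenvalues

end CoherentTransport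

end

noncomputable section

namespace CoherentTransport

/-! A uniform point of the sphere is a normalized Gaussian vector, `a = z / |z|`, with independent
standard complex Gaussian coordinates in any orthonormal basis. In an eigenbasis of `T`, with `E_k =
|z_k|²` independent standard exponential variables and `λ̄` the mean eigenvalue, this gives `α (t -
λ̄) = (∑ c_k E_k) · (n / ∑ E_k)` in law, where `c_k = (α / n) (λ_k - λ̄)`.

The second factor tends to `1` in probability by Chebyshev's inequality. In the first, the weights
sum to zero, are uniformly small by the bound on `λ_n`, and for `α = √(n+1)` have `∑ c_k²` tending
to `s²`. Its characteristic function `∏ (1 - i x c_k)⁻¹` therefore tends to `exp (-s² x² / 2)`: the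
linear terms of the logarithm cancel, the quadratic ones give the limit, and the cubic ones are
negligible (`tendstoInDistribution_weighted_sum`). Slutsky's theorem combines the factors.

`tendsto_normalizedDistribution` keeps the scale `α` and the centre free. The scale `√(n+1)` gives
the two normalized limits; the scale `1` gives convergence to the Dirac mass at `μ`, to which the
comparison Gaussians also shrink. -/

/-! ### Moments and characteristic function of `|z|²` for a complex Gaussian `z` -/

/-- The standard complex Gaussian distribution, with density `π⁻¹ exp (-|z|²)`. -/
def complexGaussian : Measure ℂ :=
  volume.withDensity fun z => ENNReal.ofReal (Real.pi⁻¹ * Real.exp (-‖z‖ ^ 2))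

theorem integral_complexGaussian {F : Type*} [NormedAddCommGroup F] [NormedSpace ℝ F] (f : ℂ → F) :
    ∫ z, f z ∂complexGaussian = ∫ z, (Real.pi⁻¹ * Real.exp (-‖z‖ ^ 2)) • f z := by
  rw [complexGaussian, integral_withDensity_eq_integral_toReal_smul (by fun_prop) (by simp)]
  refine integral_congr_ae (ae_of_all _ fun z => ?_)
  simp only
  rw [ENNReal.toReal_ofReal (by positivity)]

theorem integrable_exp_neg_norm_sq : Integrable fun z : ℂ => Real.exp (-‖z‖ ^ 2) := by
  -- A non-integrable function has Bochner integral `0`, whereas the Gaussian formula gives `π`.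
  by_contra h
  have := GaussianFourier.integral_rexp_neg_mul_sq_norm (V := ℂ) one_pos
  rw [integral_undef (by simpa using h)] at this
  simp only [div_one, Complex.finrank_real_complex] at this
  exact Real.pi_ne_zero (by simpa using this.symm)

theorem integral_exp_neg_norm_sq : ∫ z : ℂ, Real.exp (-‖z‖ ^ 2) = Real.pi := by
  simpa using GaussianFourier.integral_rexp_neg_mul_sq_norm (V := ℂ) one_pos

instance isProbabilityMeasure_complexGaussian : IsProbabilityMeasure complexGaussian := by
  constructor
  rw [complexGaussian, withDensity_apply _ MeasurableSet.univ, Measure.restrict_univ,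
    ← ofReal_integral_eq_lintegral_ofReal (integrable_exp_neg_norm_sq.const_mul _)
      (ae_of_all _ fun z => by positivity), integral_const_mul, integral_exp_neg_norm_sq,
    inv_mul_cancel₀ Real.pi_ne_zero, ENNReal.ofReal_one]

/-- `|z|²` is a standard exponential variable, so its moments are Gamma integrals. -/
theorem integral_norm_pow_complexGaussian (k : ℕ) :
    ∫ z, ‖z‖ ^ (2 * k) ∂complexGaussian = k.factorial := by
  have h := Complex.integral_rpow_mul_exp_neg_rpow (p := 2) (q := (2 * k : ℕ))
    (by norm_num) (by have : (0 : ℝ) ≤ (2 * k : ℕ) := by positivity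
                      linarith)
  rw [integral_complexGaussian]
  have : ∀ z : ℂ, (Real.pi⁻¹ * Real.exp (-‖z‖ ^ 2)) • ‖z‖ ^ (2 * k) =
      Real.pi⁻¹ * (‖z‖ ^ ((2 * k : ℕ) : ℝ) * Real.exp (-‖z‖ ^ (2 : ℝ))) := fun z => by
    rw [Real.rpow_natCast, show (2 : ℝ) = ((2 : ℕ) : ℝ) by norm_num, Real.rpow_natCast, smul_eq_mul]
    ring
  simp_rw [this]
  rw [integral_const_mul, h, show ((2 * k : ℕ) + 2 : ℝ) / 2 = k + 1 by push_cast; ring,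
    Real.Gamma_nat_eq_factorial]
  field_simp

theorem integrable_norm_pow_complexGaussian (k : ℕ) :
    Integrable (fun z => ‖z‖ ^ (2 * k)) complexGaussian := by
  by_contra h
  have := integral_norm_pow_complexGaussian k
  rw [integral_undef h] at this
  exact k.factorial_ne_zero (by exact_mod_cast this.symm)

theorem memLp_norm_sq_complexGaussian : MemLp (fun z => ‖z‖ ^ 2) 2 complexGaussian := by
  rw [memLp_two_iff_integrable_sq (by fun_prop)]
  simpa [← pow_mul] using integrable_norm_pow_complexGaussian 2

theorem integral_norm_sq_complexGaussian : ∫ z, ‖z‖ ^ 2 ∂complexGaussian = 1 := by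
  simpa using integral_norm_pow_complexGaussian 1

theorem variance_norm_sq_complexGaussian : Var[fun z => ‖z‖ ^ 2; complexGaussian] = 1 := by
  rw [variance_eq_sub memLp_norm_sq_complexGaussian, integral_norm_sq_complexGaussian]
  have := integral_norm_pow_complexGaussian 2
  simp only [Pi.pow_apply, ← pow_mul]
  rw [this]
  norm_num [Nat.factorial]

/-- The factor is absorbed into the density, leaving a Gaussian integral with complex parameter `1 -
iu`, whose real part is positive. -/
theorem integral_cexp_norm_sq_complexGaussian (u : ℝ) :
    ∫ z, Complex.exp (u * ‖z‖ ^ 2 * Complex.I) ∂complexGaussian = (1 - u * Complex.I)⁻¹ := by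
  have h := GaussianFourier.integral_cexp_neg_mul_sq_norm (V := ℂ) (b := 1 - u * Complex.I)
    (by simp)
  rw [integral_complexGaussian]
  have : ∀ z : ℂ, (Real.pi⁻¹ * Real.exp (-‖z‖ ^ 2)) • Complex.exp (u * ‖z‖ ^ 2 * Complex.I) =
      (Real.pi : ℂ)⁻¹ * Complex.exp (-(1 - u * Complex.I) * ‖z‖ ^ 2) := fun z => by
    rw [Complex.real_smul]
    push_cast
    rw [mul_assoc, ← Complex.exp_add]
    ring_nf
  simp_rw [this]
  rw [integral_const_mul, h]
  simp
  field_simp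

/-! ### The uniform distribution on the sphere from a Gaussian vector -/

theorem pi_complexGaussian (n : ℕ) :
    Measure.pi (fun _ : Fin n => complexGaussian) = (volume : Measure (Fin n → ℂ)).withDensity
      fun z => ENNReal.ofReal (∏ k, Real.pi⁻¹ * Real.exp (-‖z k‖ ^ 2)) := by
  refine (Measure.pi_eq (μ := fun _ : Fin n => complexGaussian) fun s hs => ?_)
  rw [withDensity_apply _ (MeasurableSet.univ_pi hs), volume_pi, Measure.restrict_pi_pi]
  have hi : ∀ t : Set ℂ, Integrable (fun z : ℂ => Real.pi⁻¹ * Real.exp (-‖z‖ ^ 2))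
      (volume.restrict t) := fun t => (integrable_exp_neg_norm_sq.const_mul _).restrict
  rw [← ofReal_integral_eq_lintegral_ofReal
      (Integrable.fintype_prod (μ := fun i => (volume : Measure ℂ).restrict (s i))
        (f := fun (_ : Fin n) (z : ℂ) => Real.pi⁻¹ * Real.exp (-‖z‖ ^ 2)) fun i => hi (s i))
      (ae_of_all _ fun z => by positivity),
    integral_fintype_prod_eq_prod (fun (_ : Fin n) (z : ℂ) => Real.pi⁻¹ * Real.exp (-‖z‖ ^ 2)),
    ENNReal.ofReal_prod_of_nonneg fun i _ => integral_nonneg fun z => by positivity]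
  refine Finset.prod_congr rfl fun i _ => ?_
  rw [complexGaussian, withDensity_apply _ (hs i),
    ofReal_integral_eq_lintegral_ofReal (hi (s i)) (ae_of_all _ fun z => by positivity)]

/-- Polar coordinates for the product of a function of the direction and a function of the norm. -/
theorem exists_lintegral_homogeneous_mul_norm {E : Type*} [NormedAddCommGroup E] [NormedSpace ℝ E]
    [FiniteDimensional ℝ E] [MeasurableSpace E] [BorelSpace E] [Nontrivial E]
    (ν : Measure E) [ν.IsAddHaarMeasure] {q : ℝ → ENNReal} (hq : Measurable q) :
    ∃ K : ENNReal, ∀ F : E → ENNReal, Measurable F →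
      (∀ (r : ℝ) (z : E), 0 < r → F (r • z) = F z) →
      ∫⁻ z, F z * q ‖z‖ ∂ν = K * ∫⁻ a : Metric.sphere (0 : E) 1, F a ∂ν.toSphere := by
  refine ⟨∫⁻ r : Set.Ioi (0 : ℝ), q r ∂Measure.volumeIoiPow (Module.finrank ℝ E - 1),
    fun F hF hhom => ?_⟩
  -- Polar coordinates live on the complement of the origin, which is a null set.
  have hz : ∫⁻ z, F z * q ‖z‖ ∂ν = ∫⁻ z in ({0}ᶜ : Set E), F z * q ‖z‖ ∂ν := by
    rw [Measure.restrict_eq_self_of_ae_mem (s := {0}ᶜ) (compl_mem_ae_iff.2 (measure_singleton 0))]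
  have hm : MeasurableSet ({0}ᶜ : Set E) := (measurableSet_singleton _).compl
  rw [hz, ← lintegral_subtype_comap hm, mul_comm,
    ← lintegral_prod_mul (by fun_prop) (by fun_prop),
    ← (ν.measurePreserving_homeomorphUnitSphereProd).lintegral_comp (by fun_prop)]
  refine lintegral_congr fun z => ?_
  have hz0 : 0 < ‖(z : E)‖ := norm_pos_iff.2 z.2
  simp [hhom _ _ (inv_pos.2 hz0)]

/-- Degree-zero homogeneous functions of the coordinates in an orthonormal basis have the same
distribution under the uniform distribution on the sphere and under the Gaussian distribution. -/
theorem map_uniformSphere_eq_map_pi_complexGaussian {n : ℕ} [NeZero n]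
    (b : OrthonormalBasis (Fin n) ℂ (EuclideanSpace ℂ (Fin n))) {h : (Fin n → ℂ) → ℝ}
    (hh : Measurable h) (hhom : ∀ (r : ℝ) (z : Fin n → ℂ), 0 < r → h (r • z) = h z) :
    (uniformSphere n).map (fun a => h (b.repr a.1).ofLp) =
      (Measure.pi fun _ : Fin n => complexGaussian).map h := by
  let Φ : EuclideanSpace ℂ (Fin n) ≃L[ℝ] (Fin n → ℂ) :=
    ((b.repr.toLinearEquiv.trans (WithLp.linearEquiv 2 ℂ (Fin n → ℂ))).restrictScalars
      ℝ).toContinuousLinearEquiv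
  have hΦ : ∀ z, Φ z = (b.repr z).ofLp := fun z => rfl
  have hΦ' : ∀ z, ‖z‖ ^ 2 = ∑ k, ‖Φ z k‖ ^ 2 := fun z => by
    rw [← b.repr.norm_map z, EuclideanSpace.norm_sq_eq]
    rfl
  have hΦm : Measurable Φ := Φ.continuous.measurable
  have : ((volume : Measure (EuclideanSpace ℂ (Fin n))).map Φ).IsAddHaarMeasure :=
    Φ.isAddHaarMeasure_map _
  -- Uniqueness of Haar measure up to scale; `c`, like the radial integral `K` below, is never
  -- computed.
  obtain ⟨c, hc⟩ : ∃ c : NNReal, (volume : Measure (Fin n → ℂ)) =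
      c • (volume : Measure (EuclideanSpace ℂ (Fin n))).map Φ :=
    ⟨_, Measure.isAddLeftInvariant_eq_smul _ _⟩
  let q : ℝ → ENNReal := fun r => ENNReal.ofReal ((Real.pi⁻¹) ^ n * Real.exp (-r ^ 2))
  obtain ⟨K, hK⟩ := exists_lintegral_homogeneous_mul_norm
    (volume : Measure (EuclideanSpace ℂ (Fin n))) (q := q) (by fun_prop)
  have hρ : ∀ z, ENNReal.ofReal (∏ k, Real.pi⁻¹ * Real.exp (-‖Φ z k‖ ^ 2)) = q ‖z‖ := fun z => by
    rw [Finset.prod_mul_distrib, ← Real.exp_sum, Finset.prod_const, Finset.card_univ,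
      Fintype.card_fin, Finset.sum_neg_distrib, ← (hΦ' z)]
  have key : ∀ A : Set ℝ, MeasurableSet A → (Measure.pi fun _ : Fin n => complexGaussian) (h ⁻¹' A)
      = c * K * (volume : Measure (EuclideanSpace ℂ (Fin n))).toSphere
          {a | h (b.repr a.1).ofLp ∈ A} := fun A hA => by
    have hB : MeasurableSet {z | h (Φ z) ∈ A} := (hh.comp hΦm) hA
    have hB' : MeasurableSet {a : ComplexSphere n | h (b.repr a.1).ofLp ∈ A} :=
      measurable_subtype_coe hB
    rw [pi_complexGaussian, withDensity_apply _ (hh hA), ← lintegral_indicator (hh hA), hc,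
      lintegral_smul_measure, lintegral_map _ hΦm]
    · have h1 : ∀ z, (h ⁻¹' A).indicator
          (fun z => ENNReal.ofReal (∏ k, Real.pi⁻¹ * Real.exp (-‖z k‖ ^ 2))) (Φ z) =
          {z | h (Φ z) ∈ A}.indicator 1 z * q ‖z‖ := fun z => by
        by_cases hz : h (Φ z) ∈ A <;> simp [Set.indicator, hz, hρ]
      simp_rw [h1]
      rw [hK _ (measurable_one.indicator hB)]
      · have h2 : ∀ a : ComplexSphere n, ({z | h (Φ z) ∈ A}.indicator 1 a.1 : ENNReal) =
            {a : ComplexSphere n | h (b.repr a.1).ofLp ∈ A}.indicator 1 a := fun a => rfl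
        simp_rw [h2]
        rw [lintegral_indicator_one hB', mul_assoc]
        rfl
      · intro r z hr
        have hrz : h (Φ (r • z)) = h (Φ z) := by rw [Φ.map_smul r z, hhom r _ hr]
        exact congrArg (A.indicator (1 : ℝ → ENNReal)) hrz
    · exact Measurable.indicator (by fun_prop) (hh hA)
  -- Total mass one identifies `c * K` as the normalizing constant of the sphere.
  have hone := key Set.univ MeasurableSet.univ
  simp only [Set.preimage_univ, measure_univ, Set.mem_univ, Set.ofPred_true] at hone
  have hmeas : Measurable fun a : ComplexSphere n => h (b.repr a.1).ofLp :=
    (hh.comp hΦm).comp measurable_subtype_coe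
  ext A hA
  rw [Measure.map_apply hmeas hA, Measure.map_apply hh hA, key A hA,
    ENNReal.eq_inv_of_mul_eq_one_left hone.symm, uniformSphere, Measure.smul_apply, smul_eq_mul]
  rfl

/-- The quadratic form of a Hermitian matrix in the coordinates of its eigenvector basis. -/
theorem transmissivity_eq_sum {n : ℕ} {T : Matrix (Fin n) (Fin n) ℂ} (hT : T.IsHermitian)
    (a : ComplexSphere n) :
    transmissivity T a = ∑ k, hT.eigenvalues k * ‖hT.eigenvectorBasis.repr a.1 k‖ ^ 2 := by
  have hs := Matrix.isSymmetric_toEuclideanLin_iff.mpr hT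
  have h1 : transmissivity T a = (inner ℂ a.1 (Matrix.toEuclideanLin T a.1)).re := by
    simp [transmissivity, EuclideanSpace.inner_eq_star_dotProduct, dotProduct_comm]
  have h2 : ∀ k, inner ℂ (hT.eigenvectorBasis k) (Matrix.toEuclideanLin T a.1) =
      hT.eigenvalues k * hT.eigenvectorBasis.repr a.1 k := fun k => by
    have h3 : Matrix.toEuclideanLin T (hT.eigenvectorBasis k) =
        (hT.eigenvalues k : ℂ) • hT.eigenvectorBasis k := by
      ext i
      have := congrFun (hT.mulVec_eigenvectorBasis k) i
      simpa [Matrix.toLpLin_apply] using this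
    rw [← hs, h3, inner_smul_left, Complex.conj_ofReal, OrthonormalBasis.repr_apply_apply]
  rw [h1, ← hT.eigenvectorBasis.sum_inner_mul_inner, Complex.re_sum]
  refine Finset.sum_congr rfl fun k _ => ?_
  rw [h2, ← inner_conj_symm, ← OrthonormalBasis.repr_apply_apply, mul_left_comm, Complex.conj_mul',
    ← Complex.ofReal_pow, ← Complex.ofReal_mul, Complex.ofReal_re]

theorem sum_norm_repr_sq {n : ℕ} (b : OrthonormalBasis (Fin n) ℂ (EuclideanSpace ℂ (Fin n)))
    (a : ComplexSphere n) : ∑ k, ‖b.repr a.1 k‖ ^ 2 = 1 := by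
  rw [← EuclideanSpace.norm_sq_eq, b.repr.norm_map, norm_eq_of_mem_sphere, one_pow]

/-- The law of `α (t - m)` in terms of independent complex Gaussian variables. -/
theorem map_transmissivityDistribution {n : ℕ} [NeZero n] {T : Matrix (Fin n) (Fin n) ℂ}
    (hT : T.IsHermitian) (α m : ℝ) :
    (transmissivityDistribution T).map (fun t => α * (t - m)) =
      (Measure.pi fun _ : Fin n => complexGaussian).map fun z =>
        (∑ k, α * (hT.eigenvalues k - eigenvalueMean hT) * ‖z k‖ ^ 2) / (∑ k, ‖z k‖ ^ 2) +
          α * (eigenvalueMean hT - m) := by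
  rw [transmissivityDistribution, Measure.map_map (by fun_prop)
    (continuous_transmissivity T).measurable, ← map_uniformSphere_eq_map_pi_complexGaussian
      hT.eigenvectorBasis (by fun_prop)]
  · congr 1
    ext a
    simp only [Function.comp_apply, transmissivity_eq_sum hT, sum_norm_repr_sq, div_one, mul_sub,
      sub_mul, Finset.sum_sub_distrib, ← Finset.mul_sum, mul_assoc]
    ring
  · intro r z hr
    have : ∀ k, ‖(r • z) k‖ ^ 2 = r ^ 2 * ‖z k‖ ^ 2 := fun k => by
      rw [Pi.smul_apply, norm_smul, mul_pow, Real.norm_eq_abs, sq_abs]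
    simp_rw [this, mul_left_comm _ (r ^ 2), ← Finset.mul_sum]
    rw [mul_div_mul_left _ _ (by positivity)]

/-! ### Limit theorems for sums of exponential variables -/

/-- Slutsky's theorem for random variables on varying probability spaces. -/
theorem tendstoInDistribution_comp_of_tendsto_measure_const {Ω : ℕ → Type*} {Ω' : Type*}
    [∀ n, MeasurableSpace (Ω n)] [MeasurableSpace Ω'] {P : (n : ℕ) → Measure (Ω n)}
    [∀ n, IsProbabilityMeasure (P n)] {P' : Measure Ω'} [IsProbabilityMeasure P']
    {X Y : (n : ℕ) → Ω n → ℝ} {Z : Ω' → ℝ} {c : ℝ} {g : ℝ × ℝ → ℝ} (hg : Continuous g)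
    (hX : TendstoInDistribution X atTop Z P P') (hXm : ∀ n, Measurable (X n))
    (hYm : ∀ n, Measurable (Y n))
    (hY : ∀ ε, 0 < ε → Tendsto (fun n => P n {ω | ε ≤ |Y n ω - c|}) atTop (𝓝 0)) :
    TendstoInDistribution (fun n ω => g (X n ω, Y n ω)) atTop (fun ω => g (Z ω, c)) P P' := by
  -- On the infinite product of the spaces, composing with the coordinate projections keeps every
  -- law, which reduces the claim to Slutsky's theorem on one probability space.
  have hmap : ∀ (n : ℕ) (f : Ω n → ℝ), Measurable f →
      (Measure.infinitePi P).map (fun ω => f (ω n)) = (P n).map f := fun n f hf => by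
    rw [← (measurePreserving_eval_infinitePi P n).map_eq, Measure.map_map hf (by fun_prop)]
    rfl
  have hX' : TendstoInDistribution (fun n ω => X n (ω n)) atTop Z
      (fun _ => Measure.infinitePi P) P' := by
    refine ⟨fun n => ((hXm n).comp (measurable_pi_apply n)).aemeasurable,
      hX.aemeasurable_limit, ?_⟩
    refine hX.tendsto.congr fun n => Subtype.ext ?_
    exact (hmap n _ (hXm n)).symm
  have hY' : TendstoInMeasure (Measure.infinitePi P) (fun n ω => Y n (ω n)) atTop
      (fun _ => c) := by
    rw [tendstoInMeasure_iff_dist]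
    intro ε hε
    refine (hY ε hε).congr fun n => ?_
    rw [← (measurePreserving_eval_infinitePi P n).measure_preimage]
    · rfl
    · exact (measurableSet_le measurable_const ((hYm n).sub_const c).abs).nullMeasurableSet
  have h := hX'.continuous_comp_prodMk_of_tendstoInMeasure_const hg hY'
    fun n => ((hYm n).comp (measurable_pi_apply n)).aemeasurable
  have hgm : ∀ n, Measurable fun ω => g (X n ω, Y n ω) := fun n =>
    hg.measurable.comp ((hXm n).prodMk (hYm n))
  refine ⟨fun n => (hgm n).aemeasurable, h.aemeasurable_limit, ?_⟩
  refine h.tendsto.congr fun n => Subtype.ext ?_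
  exact hmap n _ (hgm n)

/-- The characteristic function of a centered exponential variable is `exp (-u²/2)` up to a cubic
error in the exponent. -/
theorem exists_inv_one_sub_mul_I_eq_exp {u : ℝ} (hu : |u| ≤ 1 / 2) :
    ∃ w : ℂ, ‖w‖ ≤ |u| ^ 3 ∧
      (1 - u * Complex.I)⁻¹ = Complex.exp (u * Complex.I - u ^ 2 / 2 + w) := by
  have hn : ‖-(u * Complex.I)‖ = |u| := by simp
  -- The second-order Taylor remainder of the logarithm is at most `|u|³ (1 - |u|)⁻¹ / 3`, hence at
  -- most `|u|³` when `|u| ≤ 1/2`.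
  have h := Complex.norm_log_sub_logTaylor_le 2 (z := -(u * Complex.I)) (by rw [hn]; linarith)
  rw [hn] at h
  have ht : Complex.logTaylor (2 + 1) (-(u * Complex.I)) = -(u * Complex.I) + u ^ 2 / 2 := by
    simp only [Complex.logTaylor, Finset.sum_range_succ, Finset.sum_range_zero]
    ring_nf
    simp only [Complex.I_sq]
    ring
  have hne : (1 + -(u * Complex.I) : ℂ) ≠ 0 := fun h0 => by simpa using congrArg Complex.re h0
  refine ⟨-(Complex.log (1 + -(u * Complex.I)) - Complex.logTaylor (2 + 1) (-(u * Complex.I))),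
    ?_, ?_⟩
  · rw [norm_neg]
    refine h.trans ?_
    have h2 : (1 - |u|)⁻¹ ≤ 2 := by
      rw [inv_le_comm₀ (by linarith) two_pos]; linarith
    have h3 : 0 ≤ |u| ^ 3 := by positivity
    norm_num
    nlinarith
  · rw [ht, sub_eq_add_neg, ← Complex.exp_log hne, ← Complex.exp_neg, Complex.exp_log hne]
    congr 1
    ring

/-- Independence factors the characteristic function over the coordinates. -/
theorem charFun_weighted_sum {n : ℕ} (c : Fin n → ℝ) (x : ℝ) :
    charFun ((Measure.pi fun _ : Fin n => complexGaussian).map fun z => ∑ k, c k * ‖z k‖ ^ 2) x =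
      ∏ k, (1 - (x * c k : ℝ) * Complex.I)⁻¹ := by
  rw [charFun_apply_real, integral_map (Measurable.aemeasurable (by fun_prop)) (by fun_prop)]
  simp_rw [← integral_cexp_norm_sq_complexGaussian]
  rw [← integral_fintype_prod_eq_prod (𝕜 := ℂ) (μ := fun _ : Fin n => complexGaussian)
    (f := fun k (z : ℂ) => Complex.exp ((x * c k : ℝ) * ‖z‖ ^ 2 * Complex.I))]
  refine integral_congr_ae (ae_of_all _ fun z => ?_)
  simp only
  rw [← Complex.exp_sum, ← Finset.sum_mul]
  push_cast
  rw [Finset.mul_sum]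
  simp_rw [mul_assoc]

/-- The central limit theorem for centered weighted sums of exponential variables. -/
theorem tendstoInDistribution_weighted_sum {c : (n : ℕ) → Fin n → ℝ} {b : ℕ → ℝ} {v : ℝ≥0}
    (hc0 : ∀ n, ∑ k, c n k = 0) (hb : ∀ᶠ n in atTop, ∀ k, |c n k| ≤ b n)
    (hb0 : Tendsto b atTop (𝓝 0))
    (hcv : Tendsto (fun n => ∑ k, c n k ^ 2) atTop (𝓝 (v : ℝ))) :
    TendstoInDistribution (fun n (z : Fin n → ℂ) => ∑ k, c n k * ‖z k‖ ^ 2) atTop (id : ℝ → ℝ)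
      (fun n => Measure.pi fun _ : Fin n => complexGaussian) (gaussianReal 0 v) := by
  refine ⟨fun n => Measurable.aemeasurable (by fun_prop), aemeasurable_id, ?_⟩
  refine ProbabilityMeasure.tendsto_of_tendsto_charFun fun x => ?_
  simp only [ProbabilityMeasure.coe_mk, Measure.map_id, charFun_gaussianReal, charFun_weighted_sum]
  have hsmall : ∀ᶠ n in atTop, |x| * b n ≤ 1 / 2 := by
    have : Tendsto (fun n => |x| * b n) atTop (𝓝 0) := by simpa using hb0.const_mul |x|
    exact this.eventually_le_const (by norm_num)
  -- The total cubic error is controlled by `∑ |c_k|³ ≤ b ∑ c_k²`, which tends to `0`; the linear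
  -- terms vanish by `hc0`.
  have hw : ∀ᶠ n in atTop, ∃ w : ℂ, ‖w‖ ≤ |x| ^ 3 * (b n * ∑ k, c n k ^ 2) ∧
      ∏ k, (1 - (x * c n k : ℝ) * Complex.I)⁻¹ =
        Complex.exp (-(x ^ 2 * ∑ k, c n k ^ 2 : ℝ) / 2 + w) := by
    filter_upwards [hb, hsmall] with n hn hs
    have hu : ∀ k, |x * c n k| ≤ 1 / 2 := fun k => by
      rw [abs_mul]
      exact (mul_le_mul_of_nonneg_left (hn k) (abs_nonneg x)).trans hs
    choose w hw1 hw2 using fun k => exists_inv_one_sub_mul_I_eq_exp (hu k)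
    refine ⟨∑ k, w k, ?_, ?_⟩
    · refine (norm_sum_le _ _).trans ?_
      rw [Finset.mul_sum, Finset.mul_sum]
      refine Finset.sum_le_sum fun k _ => (hw1 k).trans ?_
      rw [abs_mul, mul_pow, pow_succ' |c n k|, sq_abs]
      gcongr
      exact hn k
    · simp_rw [hw2]
      rw [← Complex.exp_sum, Finset.sum_add_distrib, Finset.sum_sub_distrib, ← Finset.sum_mul,
        ← Finset.sum_div]
      have h1 : ∑ k, ((x * c n k : ℝ) : ℂ) = 0 := by
        rw [← Complex.ofReal_sum, ← Finset.mul_sum, hc0, mul_zero, Complex.ofReal_zero]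
      have h2 : ∑ k, ((x * c n k : ℝ) : ℂ) ^ 2 = ((x ^ 2 * ∑ k, c n k ^ 2 : ℝ) : ℂ) := by
        push_cast
        rw [Finset.mul_sum]
        simp_rw [mul_pow]
      rw [h1, h2]
      congr 1
      ring
  obtain ⟨w, hw⟩ := hw.choice
  have hw0 : Tendsto w atTop (𝓝 0) := by
    refine squeeze_zero_norm' (hw.mono fun n h => h.1) ?_
    simpa using (hb0.mul hcv).const_mul (|x| ^ 3)
  have hlim : Tendsto (fun n => Complex.exp (-(x ^ 2 * ∑ k, c n k ^ 2 : ℝ) / 2 + w n)) atTop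
      (𝓝 (Complex.exp (x * (0 : ℝ) * Complex.I - v * x ^ 2 / 2))) := by
    refine (Complex.continuous_exp.tendsto _).comp ?_
    have h1 : Tendsto (fun n => ((x ^ 2 * ∑ k, c n k ^ 2 : ℝ) : ℂ)) atTop
        (𝓝 ((x ^ 2 * v : ℝ) : ℂ)) :=
      (Complex.continuous_ofReal.tendsto _).comp (hcv.const_mul _)
    convert! (h1.neg.div_const 2).add hw0 using 2
    push_cast
    ring
  exact hlim.congr' (hw.mono fun n h => h.2.symm)

/-- The inverse of the mean of `n` independent standard exponential variables converges in
probability to `1`. -/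
theorem tendsto_measure_inv_mean_norm_sq {ε : ℝ} (hε : 0 < ε) :
    Tendsto (fun n : ℕ => (Measure.pi fun _ : Fin n => complexGaussian)
      {z | ε ≤ |(n : ℝ) / (∑ k, ‖z k‖ ^ 2) - 1|}) atTop (𝓝 0) := by
  -- Chosen so that `δ / (1 - δ) = ε`: if the sum is within `δ n` of `n`, then `n` divided by the
  -- sum is within `ε` of `1`.
  set δ : ℝ := ε / (1 + ε) with hδ
  have hδ0 : 0 < δ := by positivity
  have hδ1 : δ < 1 := by rw [hδ, div_lt_one (by positivity)]; linarith
  have hmem : ∀ n : ℕ, ∀ k ∈ (Finset.univ : Finset (Fin n)), MemLp (fun z : Fin n → ℂ => ‖z k‖ ^ 2) 2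
      (Measure.pi fun _ : Fin n => complexGaussian) := fun n k _ =>
    memLp_norm_sq_complexGaussian.comp_measurePreserving
      (measurePreserving_eval (fun _ : Fin n => complexGaussian) k)
  have hbound : ∀ n : ℕ, 0 < n → (Measure.pi fun _ : Fin n => complexGaussian)
      {z | ε ≤ |(n : ℝ) / (∑ k, ‖z k‖ ^ 2) - 1|} ≤ ENNReal.ofReal (1 / δ ^ 2 / n) := by
    intro n hn
    have hn' : (0 : ℝ) < n := by exact_mod_cast hn
    have hsum : MemLp (fun z : Fin n → ℂ => ∑ k, ‖z k‖ ^ 2) 2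
        (Measure.pi fun _ : Fin n => complexGaussian) := memLp_finsetSum _ (hmem n)
    have hcheb := meas_ge_le_variance_div_sq hsum (mul_pos hδ0 hn')
    have hvar : Var[fun z : Fin n → ℂ => ∑ k, ‖z k‖ ^ 2;
        Measure.pi fun _ : Fin n => complexGaussian] = n := by
      have := variance_sum_pi (μ := fun _ : Fin n => complexGaussian)
        (X := fun _ z => ‖z‖ ^ 2) fun _ => memLp_norm_sq_complexGaussian
      rw [variance_norm_sq_complexGaussian] at this
      convert! this using 2
      · ext z; simp
      · simp
    have hmean : ∫ z : Fin n → ℂ, ∑ k, ‖z k‖ ^ 2 ∂(Measure.pi fun _ : Fin n => complexGaussian)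
        = n := by
      rw [integral_finsetSum _ fun k hk => (hmem n k hk).integrable one_le_two]
      have : ∀ k : Fin n, ∫ z : Fin n → ℂ, ‖z k‖ ^ 2
          ∂(Measure.pi fun _ : Fin n => complexGaussian) = 1 := fun k => by
        have hmp := measurePreserving_eval (fun _ : Fin n => complexGaussian) k
        rw [← integral_norm_sq_complexGaussian]
        nth_rewrite 2 [← hmp.map_eq]
        rw [integral_map hmp.measurable.aemeasurable (by fun_prop)]
      simp [this]
    rw [hvar, hmean] at hcheb
    refine (measure_mono fun z hz => ?_).trans (hcheb.trans_eq ?_)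
    · simp only [Set.mem_ofPred_eq] at hz ⊢
      by_contra! hlt
      set S := ∑ k, ‖z k‖ ^ 2
      have h1 : (1 - δ) * n < S := by nlinarith [(abs_lt.1 hlt).1]
      have hS : 0 < S := lt_trans (by have := sub_pos.2 hδ1; positivity) h1
      have h2 : |(n : ℝ) / S - 1| = |S - n| / S := by
        rw [div_sub_one hS.ne', abs_div, abs_of_pos hS, abs_sub_comm]
      rw [h2, le_div_iff₀ hS] at hz
      have h3 : ε * (1 - δ) = δ := by rw [hδ]; field_simp; ring
      nlinarith
    · congr 1
      field_simp
  have hlim : Tendsto (fun n : ℕ => ENNReal.ofReal (1 / δ ^ 2 / n)) atTop (𝓝 0) := by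
    rw [← ENNReal.ofReal_zero]
    exact (ENNReal.continuous_ofReal.tendsto _).comp (tendsto_const_div_atTop_nhds_zero_nat _)
  refine tendsto_of_tendsto_of_tendsto_of_le_of_le' tendsto_const_nhds hlim
    (Eventually.of_forall fun _ => zero_le) ((eventually_gt_atTop 0).mono hbound)

/-! ### Mean and variance of the eigenvalues -/

theorem two_mul_sum_sum_Iio {n : ℕ} (f : Fin n → Fin n → ℝ) (hsymm : ∀ i j, f i j = f j i)
    (hdiag : ∀ i, f i i = 0) : 2 * ∑ i, ∑ j ∈ Finset.Iio i, f i j = ∑ i, ∑ j, f i j := by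
  have h1 : ∑ i, ∑ j ∈ Finset.Iio i, f i j = ∑ i, ∑ j, if j < i then f i j else 0 := by
    refine Finset.sum_congr rfl fun i _ => ?_
    rw [← Finset.sum_filter]
    congr 1
    ext j
    simp
  have h2 : ∑ i, ∑ j, (if j < i then f i j else 0) = ∑ i, ∑ j, if i < j then f i j else 0 := by
    rw [Finset.sum_comm]
    exact Finset.sum_congr rfl fun i _ => Finset.sum_congr rfl fun j _ => by rw [hsymm]
  rw [two_mul, h1]
  nth_rewrite 2 [h2]
  simp_rw [← Finset.sum_add_distrib]
  refine Finset.sum_congr rfl fun i _ => Finset.sum_congr rfl fun j _ => ?_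
  rcases lt_trichotomy i j with h | rfl | h
  · simp [h, h.not_gt]
  · simp [hdiag]
  · simp [h, h.not_gt]

section Eigenvalues

variable {n : ℕ} {T : Matrix (Fin n) (Fin n) ℂ}

theorem sum_eigenvalues_eq (hn : 0 < n) (hT : T.IsHermitian) :
    ∑ i, hT.eigenvalues i = n * eigenvalueMean hT := by
  have : (n : ℝ) ≠ 0 := by exact_mod_cast hn.ne'
  rw [eigenvalueMean]
  field_simp

theorem sum_eigenvalues_sub_mean (hT : T.IsHermitian) :
    ∑ i, (hT.eigenvalues i - eigenvalueMean hT) = 0 := by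
  rcases n.eq_zero_or_pos with rfl | hn
  · simp
  · simp [Finset.sum_sub_distrib, sum_eigenvalues_eq hn]

/-- Symmetry turns the sum over pairs into half the full double sum, which expands into power sums.
-/
theorem eigenvalueVariance_eq (hn : 0 < n) (hT : T.IsHermitian) :
    eigenvalueVariance hT =
      (1 / (n : ℝ)) * ∑ i, hT.eigenvalues i ^ 2 - eigenvalueMean hT ^ 2 := by
  have hn0 : (n : ℝ) ≠ 0 := by exact_mod_cast hn.ne'
  have h := two_mul_sum_sum_Iio (fun i j => (hT.eigenvalues i - hT.eigenvalues j) ^ 2)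
    (fun i j => by ring) (fun i => by ring)
  have hfull : ∑ i, ∑ j, (hT.eigenvalues i - hT.eigenvalues j) ^ 2 =
      2 * (n * ∑ i, hT.eigenvalues i ^ 2 - n ^ 2 * eigenvalueMean hT ^ 2) := by
    simp only [sub_sq, Finset.sum_add_distrib, Finset.sum_sub_distrib, Finset.sum_const,
      Finset.card_univ, Fintype.card_fin, nsmul_eq_mul, mul_assoc, ← Finset.mul_sum,
      ← Finset.sum_mul, sum_eigenvalues_eq hn hT]
    ring
  have h' : ∑ i, ∑ j ∈ Finset.Iio i, (hT.eigenvalues i - hT.eigenvalues j) ^ 2 =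
      n * ∑ i, hT.eigenvalues i ^ 2 - n ^ 2 * eigenvalueMean hT ^ 2 := by
    linarith
  rw [eigenvalueVariance, h']
  field_simp

theorem sum_sq_eigenvalues_sub_mean (hn : 0 < n) (hT : T.IsHermitian) :
    ∑ i, (hT.eigenvalues i - eigenvalueMean hT) ^ 2 = n * eigenvalueVariance hT := by
  have hn0 : (n : ℝ) ≠ 0 := by exact_mod_cast hn.ne'
  rw [eigenvalueVariance_eq hn hT]
  simp only [sub_sq, Finset.sum_add_distrib, Finset.sum_sub_distrib, ← Finset.sum_mul,
    ← Finset.mul_sum, sum_eigenvalues_eq hn hT, Finset.sum_const, Finset.card_univ,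
    Fintype.card_fin, nsmul_eq_mul]
  field_simp
  ring

theorem eigenvalues_le_maxEigenvalue (hT : T.IsHermitian) (i : Fin n) :
    hT.eigenvalues i ≤ maxEigenvalue hT :=
  le_ciSup (Set.finite_range _).bddAbove i

/-- By positivity, each eigenvalue and the mean both lie in `[0, λ_n]`. -/
theorem abs_eigenvalues_sub_mean_le (hT : T.PosSemidef) (i : Fin n) :
    |hT.isHermitian.eigenvalues i - eigenvalueMean hT.isHermitian| ≤
      maxEigenvalue hT.isHermitian := by
  have hn : 0 < n := i.pos
  have hn0 : (0 : ℝ) < n := by exact_mod_cast hn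
  have hsum := sum_eigenvalues_eq hn hT.isHermitian
  have h0 : 0 ≤ eigenvalueMean hT.isHermitian := by
    have : 0 ≤ ∑ i, hT.isHermitian.eigenvalues i :=
      Finset.sum_nonneg fun i _ => hT.eigenvalues_nonneg i
    rw [hsum] at this
    exact nonneg_of_mul_nonneg_right this hn0
  have h1 : eigenvalueMean hT.isHermitian ≤ maxEigenvalue hT.isHermitian := by
    have : ∑ i, hT.isHermitian.eigenvalues i ≤ ∑ _i : Fin n, maxEigenvalue hT.isHermitian :=
      Finset.sum_le_sum fun i _ => eigenvalues_le_maxEigenvalue _ i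
    rw [hsum, Finset.sum_const, Finset.card_univ, Fintype.card_fin, nsmul_eq_mul] at this
    exact le_of_mul_le_mul_left this hn0
  have h2 := hT.eigenvalues_nonneg i
  have h3 := eigenvalues_le_maxEigenvalue hT.isHermitian i
  rw [abs_le]
  constructor <;> linarith

theorem maxEigenvalue_mem_Icc (hT : T.IsHermitian)
    (h : ∀ i, hT.eigenvalues i ∈ Set.Icc (0 : ℝ) 1) : maxEigenvalue hT ∈ Set.Icc (0 : ℝ) 1 :=
  ⟨Real.iSup_nonneg fun i => (h i).1, Real.iSup_le (fun i => (h i).2) zero_le_one⟩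

/-- On `[0, 1]` one has `λ² ≤ λ`, so the variance is at most `m - m² ≤ 1/4`, with `m` the mean. -/
theorem eigenvalueVariance_le_quarter (hT : T.IsHermitian)
    (h : ∀ i, hT.eigenvalues i ∈ Set.Icc (0 : ℝ) 1) : eigenvalueVariance hT ≤ 1 / 4 := by
  rcases n.eq_zero_or_pos with rfl | hn
  · simp [eigenvalueVariance]
  · have hsq : ∑ i, hT.eigenvalues i ^ 2 ≤ ∑ i, hT.eigenvalues i :=
      Finset.sum_le_sum fun i _ => by nlinarith [(h i).1, (h i).2]
    have : (1 / (n : ℝ)) * ∑ i, hT.eigenvalues i ^ 2 ≤ eigenvalueMean hT :=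
      mul_le_mul_of_nonneg_left hsq (by positivity)
    rw [eigenvalueVariance_eq hn]
    nlinarith [sq_nonneg (eigenvalueMean hT - 1 / 2)]

theorem eigenvalueVariance_eq_quarter (hn : 0 < n) (hT : T.IsHermitian)
    (h : ∀ i, hT.eigenvalues i ∈ Set.Icc (0 : ℝ) 1)
    (h0 : 2 * {i | hT.eigenvalues i = 0}.ncard = n)
    (h1 : 2 * {i | hT.eigenvalues i = 1}.ncard = n) : eigenvalueVariance hT = 1 / 4 := by
  have hn0 : (0 : ℝ) < n := by exact_mod_cast hn
  have hcard : ∀ x : ℝ, 2 * {i | hT.eigenvalues i = x}.ncard = n →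
      ∑ i, (if hT.eigenvalues i = x then (1 : ℝ) else 0) = n / 2 := fun x hx => by
    rw [Finset.sum_boole]
    have : {i | hT.eigenvalues i = x}.ncard =
        (Finset.univ.filter fun i => hT.eigenvalues i = x).card := by
      rw [← Set.ncard_coe_finset]
      simp
    rw [this] at hx
    have : (2 : ℝ) * (Finset.univ.filter fun i => hT.eigenvalues i = x).card = n := by
      exact_mod_cast hx
    linarith
  -- The chain `n/2 ≤ ∑ λ² ≤ ∑ λ ≤ n/2` forces equality throughout.
  have hlow : ∑ i, (if hT.eigenvalues i = 1 then (1 : ℝ) else 0) ≤ ∑ i, hT.eigenvalues i ^ 2 :=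
    Finset.sum_le_sum fun i _ => by
      split_ifs with hi
      · rw [hi]; norm_num
      · positivity
  have hsq : ∑ i, hT.eigenvalues i ^ 2 ≤ ∑ i, hT.eigenvalues i :=
    Finset.sum_le_sum fun i _ => by nlinarith [(h i).1, (h i).2]
  have hup : ∑ i, (if hT.eigenvalues i = 0 then (1 : ℝ) else 0) ≤ ∑ i, (1 - hT.eigenvalues i) :=
    Finset.sum_le_sum fun i _ => by
      split_ifs with hi
      · rw [hi]; norm_num
      · linarith [(h i).2]
  rw [hcard 1 h1] at hlow
  rw [hcard 0 h0, Finset.sum_sub_distrib, Finset.sum_const, Finset.card_univ, Fintype.card_fin,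
    nsmul_eq_mul, mul_one] at hup
  have hs : ∑ i, hT.eigenvalues i = n / 2 := by linarith
  have hs2 : ∑ i, hT.eigenvalues i ^ 2 = n / 2 := by linarith
  rw [eigenvalueVariance_eq hn, eigenvalueMean, hs, hs2]
  field_simp
  norm_num

end Eigenvalues

/-! ### Convergence of the normalized transmissivity -/

/-- The central limit theorem for the law of `α_n (t - m_n)`, whenever `α_n = O(√n)`, the variances
converge and the means converge. -/
theorem tendsto_normalizedDistribution {T : (n : ℕ) → Matrix (Fin n) (Fin n) ℂ}
    (hT : ∀ n, (T n).PosSemidef) {α m : ℕ → ℝ} {d : ℝ} {v : ℝ≥0}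
    (hα : ∀ n : ℕ, |α n| ≤ √((n : ℝ) + 1))
    (hmax : Tendsto (fun n : ℕ => Real.log n / √(n : ℝ) * maxEigenvalue (hT n).isHermitian)
      atTop (𝓝 0))
    (hvar : Tendsto (fun n : ℕ => α n ^ 2 / n * eigenvalueVariance (hT n).isHermitian) atTop
      (𝓝 (v : ℝ)))
    (hmean : Tendsto (fun n => α n * (eigenvalueMean (hT n).isHermitian - m n)) atTop (𝓝 d)) :
    Tendsto (fun n => normalizedDistribution (T n) (α n) (m n)) atTop
      (𝓝 (normalDistribution d v)) := by
  let c : (n : ℕ) → Fin n → ℝ := fun n k => α n / n *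
    ((hT n).isHermitian.eigenvalues k - eigenvalueMean (hT n).isHermitian)
  have hc0 : ∀ n, ∑ k, c n k = 0 := fun n => by
    rw [← Finset.mul_sum, sum_eigenvalues_sub_mean, mul_zero]
  have hb : ∀ᶠ n : ℕ in atTop, ∀ k, |c n k| ≤
      2 * (Real.log n / √(n : ℝ) * maxEigenvalue (hT n).isHermitian) := by
    -- From `n = 3` on, `log n ≥ 1`, so the logarithm only weakens the bound; the factor `2` comes
    -- from `√(n+1) ≤ 2√n`.
    filter_upwards [eventually_ge_atTop 3] with n hn k
    have hn3 : (3 : ℝ) ≤ n := by exact_mod_cast hn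
    have hlog : 1 ≤ Real.log n := by
      rw [Real.le_log_iff_exp_le (by linarith)]
      linarith [Real.exp_one_lt_d9]
    have hs : √((n : ℝ) + 1) ≤ 2 * √(n : ℝ) := by
      rw [Real.sqrt_le_left (by positivity), mul_pow, Real.sq_sqrt (by linarith)]
      linarith
    have h1 : |α n| / n ≤ 2 * (Real.log n / √(n : ℝ)) := by
      have : |α n| / n ≤ 2 * √(n : ℝ) / n := by
        gcongr
        exact (hα n).trans hs
      rw [mul_div_assoc, Real.sqrt_div_self'] at this
      refine this.trans ?_
      gcongr
    rw [abs_mul, abs_div, Nat.abs_cast, ← mul_assoc]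
    exact mul_le_mul h1 (abs_eigenvalues_sub_mean_le (hT n) k) (abs_nonneg _) (by positivity)
  have hcv : Tendsto (fun n => ∑ k, c n k ^ 2) atTop (𝓝 (v : ℝ)) := by
    refine hvar.congr' ?_
    filter_upwards [eventually_gt_atTop 0] with n hn
    have hn0 : (n : ℝ) ≠ 0 := by exact_mod_cast hn.ne'
    simp only [c, mul_pow]
    rw [← Finset.mul_sum, sum_sq_eigenvalues_sub_mean hn]
    field_simp
  have h1 := tendstoInDistribution_weighted_sum hc0 hb (by simpa using hmax.const_mul 2) hcv
  have h2 := tendstoInDistribution_comp_of_tendsto_measure_const (g := fun p : ℝ × ℝ => p.1 * p.2)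
    (Y := fun (n : ℕ) (z : Fin n → ℂ) => (n : ℝ) / (∑ k, ‖z k‖ ^ 2)) (c := 1) (by fun_prop) h1
    (fun n => by fun_prop) (fun n => by fun_prop) fun ε hε => tendsto_measure_inv_mean_norm_sq hε
  have h3 := tendstoInDistribution_comp_of_tendsto_measure_const (g := fun p : ℝ × ℝ => p.1 + p.2)
    (Y := fun (n : ℕ) (_ : Fin n → ℂ) => α n * (eigenvalueMean (hT n).isHermitian - m n)) (c := d)
    (by fun_prop) h2 (fun n => by fun_prop) (fun n => measurable_const) fun ε hε => by
      refine tendsto_const_nhds.congr' ?_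
      filter_upwards [Metric.tendsto_nhds.1 hmean ε hε] with n hn
      rw [Real.dist_eq] at hn
      simp [hn.not_ge]
  have h4 := Tendsto.comp (β := ProbabilityMeasure ℝ)
    (ProbabilityMeasure.toFiniteMeasure_continuous.tendsto _) h3.tendsto
  have hlim : normalDistribution d v = ProbabilityMeasure.toFiniteMeasure
      (⟨(gaussianReal 0 v).map fun x => id x * 1 + d,
        Measure.isProbabilityMeasure_map h3.aemeasurable_limit⟩ : ProbabilityMeasure ℝ) := by
    refine Subtype.ext ?_
    simp only [id, mul_one]
    change gaussianReal d v = (gaussianReal 0 v).map fun x => x + d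
    rw [gaussianReal_map_add_const, zero_add]
  rw [hlim]
  refine h4.congr' ?_
  -- For `n = 0` the sphere is empty and the law is the zero measure, so the identification of laws
  -- needs `n > 0`.
  filter_upwards [eventually_gt_atTop 0] with n hn
  have : NeZero n := ⟨hn.ne'⟩
  have hn0 : (n : ℝ) ≠ 0 := by exact_mod_cast hn.ne'
  refine Subtype.ext ?_
  refine Eq.trans ?_ (map_transmissivityDistribution (hT n).isHermitian (α n) (m n)).symm
  change Measure.map _ _ = _
  congr 1
  ext z
  simp only [c]
  rw [← mul_div_assoc, Finset.sum_mul]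
  congr 2
  refine Finset.sum_congr rfl fun k _ => ?_
  field_simp

/-- Characteristic functions handle the degenerate limit `v₀ = 0`, a Dirac mass, on the same
footing. -/
theorem tendsto_gaussianReal_of_tendsto_variance {v : ℕ → ℝ≥0} {v₀ : ℝ≥0} (μ : ℝ)
    (hv : Tendsto v atTop (𝓝 v₀)) (f : ℝ →ᵇ ℝ) :
    Tendsto (fun n => ∫ t, f t ∂gaussianReal μ (v n)) atTop (𝓝 (∫ t, f t ∂gaussianReal μ v₀)) := by
  have h : Tendsto (β := ProbabilityMeasure ℝ)
      (fun n => (⟨gaussianReal μ (v n), inferInstance⟩ : ProbabilityMeasure ℝ)) atTop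
      (𝓝 (⟨gaussianReal μ v₀, inferInstance⟩ : ProbabilityMeasure ℝ)) := by
    refine ProbabilityMeasure.tendsto_of_tendsto_charFun fun x => ?_
    simp only [ProbabilityMeasure.coe_mk, charFun_gaussianReal]
    refine (Complex.continuous_exp.tendsto _).comp ?_
    have hv' : Tendsto (fun n => ((v n : ℝ) : ℂ)) atTop (𝓝 ((v₀ : ℝ) : ℂ)) :=
      ((Complex.continuous_ofReal.comp NNReal.continuous_coe).tendsto _).comp hv
    exact tendsto_const_nhds.sub ((hv'.mul_const _).div_const _)
  exact ProbabilityMeasure.tendsto_iff_forall_integral_tendsto.1 h f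

theorem tendsto_log_div_sqrt : Tendsto (fun n : ℕ => Real.log n / √(n : ℝ)) atTop (𝓝 0) := by
  have h := (isLittleO_log_rpow_atTop (r := 1 / 2) (by norm_num)).tendsto_div_nhds_zero
  simp_rw [← Real.sqrt_eq_rpow] at h
  exact h.comp tendsto_natCast_atTop_atTop

theorem tendsto_succ_div_self : Tendsto (fun n : ℕ => ((n : ℝ) + 1) / n) atTop (𝓝 1) := by
  have h : Tendsto (fun n : ℕ => 1 + 1 / (n : ℝ)) atTop (𝓝 (1 + 0)) :=
    tendsto_const_nhds.add (tendsto_const_div_atTop_nhds_zero_nat 1)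
  rw [add_zero] at h
  refine h.congr' ?_
  filter_upwards [eventually_gt_atTop 0] with n hn
  have hn0 : (n : ℝ) ≠ 0 := by exact_mod_cast hn.ne'
  field_simp

end CoherentTransport

end

/-! ### The three limits and passive systems -/

theorem mainTheorem2 (T : (n : ℕ) → Matrix (Fin n) (Fin n) ℂ) (hT : ∀ n, (T n).PosSemidef) :
    -- the central limit theorem
    (∀ μ s : ℝ,
      Tendsto (fun n : ℕ => Real.log n / √(n : ℝ) *
        CoherentTransport.maxEigenvalue (hT n).isHermitian) atTop (𝓝 0) →
      Tendsto (fun n : ℕ => CoherentTransport.eigenvalueMean (hT n).isHermitian) atTop (𝓝 μ) →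
      Tendsto (fun n : ℕ => CoherentTransport.eigenvalueVariance (hT n).isHermitian) atTop
        (𝓝 (s ^ 2)) →
      -- normalized by the exact mean of `p_n(t; T_n)`
      Tendsto (fun n : ℕ => CoherentTransport.normalizedDistribution (T n) √((n : ℝ) + 1)
          (CoherentTransport.eigenvalueMean (hT n).isHermitian)) atTop
        (𝓝 (CoherentTransport.normalDistribution 0 (s ^ 2).toNNReal)) ∧
      -- normalized by the limit `μ`, when the means converge to it fast enough
      (Tendsto (fun n : ℕ => √(n : ℝ) *
          (CoherentTransport.eigenvalueMean (hT n).isHermitian - μ)) atTop (𝓝 0) →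
        Tendsto (fun n : ℕ => CoherentTransport.normalizedDistribution (T n) √((n : ℝ) + 1) μ) atTop
          (𝓝 (CoherentTransport.normalDistribution 0 (s ^ 2).toNNReal))) ∧
      -- without normalization
      (∀ f : ℝ →ᵇ ℝ, Tendsto (fun n : ℕ =>
          (∫ t, f t ∂(CoherentTransport.transmissivityDistribution (T n))) -
            ∫ t, f t ∂(gaussianReal μ (s ^ 2 / ((n : ℝ) + 1)).toNNReal)) atTop (𝓝 0))) ∧
    -- passive systems
    ((∀ n i, (hT n).isHermitian.eigenvalues i ∈ Set.Icc (0 : ℝ) 1) →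
      Tendsto (fun n : ℕ => Real.log n / √(n : ℝ) *
        CoherentTransport.maxEigenvalue (hT n).isHermitian) atTop (𝓝 0) ∧
      (∀ s : ℝ,
        Tendsto (fun n : ℕ => CoherentTransport.eigenvalueVariance (hT n).isHermitian) atTop
          (𝓝 (s ^ 2)) →
        (∀ n : ℕ, s ^ 2 / ((n : ℝ) + 1) ≤ 1 / (4 * ((n : ℝ) + 1))) ∧
        -- equality if half of the eigenvalues are `0` and half are `1`, for infinitely many `n`
        ((∃ᶠ n : ℕ in atTop,
            2 * {i | (hT n).isHermitian.eigenvalues i = 0}.ncard = n ∧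
            2 * {i | (hT n).isHermitian.eigenvalues i = 1}.ncard = n) →
          ∀ n : ℕ, s ^ 2 / ((n : ℝ) + 1) = 1 / (4 * ((n : ℝ) + 1))))) := by
  refine ⟨fun μ s hmax hmean hvar => ?_, fun hpass => ⟨?_, fun s hvar => ?_⟩⟩
  · have hv1 : Tendsto (fun n : ℕ => √((n : ℝ) + 1) ^ 2 / n *
        CoherentTransport.eigenvalueVariance (hT n).isHermitian) atTop
        (𝓝 ((s ^ 2).toNNReal : ℝ)) := by
      rw [Real.coe_toNNReal _ (sq_nonneg s), ← one_mul (s ^ 2)]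
      refine (CoherentTransport.tendsto_succ_div_self.mul hvar).congr fun n => ?_
      rw [Real.sq_sqrt (by positivity)]
    have habs : ∀ n : ℕ, |√((n : ℝ) + 1)| ≤ √((n : ℝ) + 1) := fun n => by
      rw [abs_of_nonneg (Real.sqrt_nonneg _)]
    refine ⟨CoherentTransport.tendsto_normalizedDistribution hT habs hmax hv1 (by simp),
      fun hfast => CoherentTransport.tendsto_normalizedDistribution hT habs hmax hv1 ?_,
      fun f => ?_⟩
    -- The scale changes through `√(n+1) = √((n+1)/n) · √n`.
    · have h1 := ((Real.continuous_sqrt.tendsto _).comp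
        CoherentTransport.tendsto_succ_div_self).mul hfast
      rw [mul_zero] at h1
      refine h1.congr' ?_
      filter_upwards [eventually_gt_atTop 0] with n hn
      have hn0 : √(n : ℝ) ≠ 0 := (Real.sqrt_pos.2 (by exact_mod_cast hn)).ne'
      simp only [Function.comp_apply]
      rw [Real.sqrt_div' _ (Nat.cast_nonneg n)]
      field_simp
    -- With scale `1` the limiting variance is `0`, so both integrals tend to `f μ`.
    · have h1 : Tendsto (fun n => CoherentTransport.normalizedDistribution (T n) 1 0) atTop
          (𝓝 (CoherentTransport.normalDistribution μ 0)) := by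
        refine CoherentTransport.tendsto_normalizedDistribution hT (α := fun _ => 1)
          (m := fun _ => 0) (fun n => ?_) hmax ?_ (by simpa using hmean)
        · rw [abs_one, Real.one_le_sqrt]
          linarith [(Nat.cast_nonneg n : (0 : ℝ) ≤ n)]
        · simpa using (tendsto_const_div_atTop_nhds_zero_nat (1 : ℝ)).mul hvar
      have h2 := FiniteMeasure.tendsto_iff_forall_integral_tendsto.1 h1 f
      have h3 : Tendsto (fun n : ℕ => (s ^ 2 / ((n : ℝ) + 1)).toNNReal) atTop (𝓝 0) := by
        rw [← Real.toNNReal_zero]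
        refine (continuous_real_toNNReal.tendsto _).comp ?_
        simpa [div_eq_mul_inv] using
          (tendsto_one_div_add_atTop_nhds_zero_nat (𝕜 := ℝ)).const_mul (s ^ 2)
      have h4 := h2.sub (CoherentTransport.tendsto_gaussianReal_of_tendsto_variance μ h3 f)
      have h5 : ∀ n, (CoherentTransport.normalizedDistribution (T n) 1 0 : Measure ℝ) =
          CoherentTransport.transmissivityDistribution (T n) := fun n => by
        change Measure.map _ _ = _
        simp
      simp_rw [h5] at h4
      rwa [show (CoherentTransport.normalDistribution μ 0 : Measure ℝ) = gaussianReal μ 0 from rfl,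
        sub_self] at h4
  · refine squeeze_zero (fun n => ?_) (fun n => ?_) CoherentTransport.tendsto_log_div_sqrt
    · exact mul_nonneg (div_nonneg (Real.log_natCast_nonneg n) (Real.sqrt_nonneg _))
        (CoherentTransport.maxEigenvalue_mem_Icc _ (hpass n)).1
    · exact mul_le_of_le_one_right (div_nonneg (Real.log_natCast_nonneg n) (Real.sqrt_nonneg _))
        (CoherentTransport.maxEigenvalue_mem_Icc _ (hpass n)).2
  · have hdiv : ∀ n : ℕ, 1 / (4 * ((n : ℝ) + 1)) = 1 / 4 / ((n : ℝ) + 1) := fun n => by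
      rw [div_div]
    refine ⟨fun n => ?_, fun hfreq n => ?_⟩
    · rw [hdiv]
      gcongr
      exact le_of_tendsto' hvar fun n =>
        CoherentTransport.eigenvalueVariance_le_quarter _ (hpass n)
    · rw [hdiv]
      congr 1
      -- If `s² ≠ 1/4`, the variances eventually avoid `1/4`, yet they equal it infinitely often.
      by_contra hne
      obtain ⟨k, ⟨⟨h0, h1⟩, hk⟩, hk0⟩ := ((hfreq.and_eventually
        (hvar.eventually_ne hne)).and_eventually (eventually_gt_atTop 0)).exists
      exact hk (CoherentTransport.eigenvalueVariance_eq_quarter hk0 _ (hpass k) h0 h1)
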